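/- Work in the simply typed $\lambda$-calculus with unification variables, in de Bruijn notation (types are built from atomic types by $\to$; terms are considered modulo $\beta\eta$; unification variables are not affected by $\beta$-reduction and are substituted without capture, by terms of the context of the problem), and in the simply typed $\lambda\sigma$-calculus (rules App, VarCons, Id, Abs, Clos, IdL, IdR, ShiftCons, AssEnv, MapEnv, VarShift, SCons of $\sigma$, together with Beta and Eta) with unification variables $X$ of the sort of terms, each with a sort $(\Gamma_X,T_X)$, meaning $\Gamma_X\vdash X:T_X$, and infinitely many of each sort. In a context $A.\Gamma$ the index $1$ has type $A$. A substitution maps every unification variable of the $\lambda\sigma$-calculus to a term of the same sort and is applied by first-order replacement. Let $a=b$ be a unification problem of the $\lambda$-calculus, i.e. $a$ and $b$ are $\lambda$-terms of the same type in the same context $\Gamma$ (in particular, $a=b$ may be any second-order unification problem; no bound on the order is needed). Let $a_F,b_F$ be the precookings of $a,b$: the index $k$ is translated to $1[\uparrow^{k-1}]$, and a unification variable $X$ of type $A$ occurring below $n$ binders to $X[\uparrow^n]$, with $X$ of sort $(\Gamma,A)$. Let $\sigma$ be the substitution mapping every variable $X$ of sort $(\Gamma, A_1\to\dots\to A_n\to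 B)$, $B$ atomic, occurring in $a_F=b_F$, to $\lambda_{A_1}\dots\lambda_{A_n}Y_X$, where the $Y_X$ are new, pairwise distinct variables, $Y_X$ of sort $(A_n.\,\cdots.A_1.\Gamma,\ B)$, and fixing all other variables. Let $\tilde a$ and $\tilde b$ be $\lambda\sigma$-normal forms of $\sigma a_F$ and $\sigma b_F$. Call a $\lambda\sigma$-term simple if each of its subterms $X[s]$, with $X$ a unification variable, has $s=\uparrow^n$ for some $n\ge 0$ (where $\uparrow^0=\mathrm{id}$, $\uparrow^1=\uparrow$, $\uparrow^{n+1}=\uparrow\circ\uparrow^n$), and a substitution $\theta$ simple if $\theta X$ is simple for every $X$. Then the following are equivalent: (i) $a=b$ has a solution in the $\lambda$-calculus, i.e. $\theta a=_{\beta\eta}\theta b$ for some substitution $\theta$ of terms of context $\Gamma$ for the unification variables; (ii) $\tilde a=\tilde b$ has a simple solution, i.e. $\theta\tilde a=_{\lambda\sigma}\theta\tilde b$ for some simple $\theta$; (iii) $\tilde a=\tilde b$ has a simple solution $\theta$ such that every $\theta X$ is moreover $\sigma$-normal (so that its only closures are of the forms $1[\uparrow^n]$ and $X[\uparrow^n]$).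 -/

import Mathlib

namespace LambdaSigma

universe u

/-- Simple types over a set `ι` of atomic types. -/
inductive Ty (ι : Type u) : Type u
  | base : ι → Ty ι
  | arr : Ty ι → Ty ι → Ty ι

/-- Contexts; the head of the list is the type of the de Bruijn index `1`, so `A :: Γ` is the
context written `A.Γ`. -/
abbrev Ctx (ι : Type u) : Type u := List (Ty ι)

/-- The atomic type `B` of `A₁ → ⋯ → Aₙ → B`. -/
def Ty.target {ι : Type u} : Ty ι → ι
  | .base i => i
  | .arr _ B => B.target

/-- For `A = A₁ → ⋯ → Aₙ → B` with `B` atomic, the context `Aₙ. ⋯ .A₁.Γ` of the body of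
`λ_{A₁} ⋯ λ_{Aₙ}` in `Γ`. -/
def Ty.bodyCtx {ι : Type u} : Ty ι → Ctx ι → Ctx ι
  | .base _, Γ => Γ
  | .arr A B, Γ => B.bodyCtx (A :: Γ)

/-! ### Simply typed `λ`-calculus with unification variables, in de Bruijn notation -/

/-- `Var Γ A`: the de Bruijn indices of type `A` in `Γ` (`zero` is the index `1`). -/
inductive Var {ι : Type u} : Ctx ι → Ty ι → Type u
  | zero {Γ : Ctx ι} {A : Ty ι} : Var (A :: Γ) A
  | succ {Γ : Ctx ι} {A B : Ty ι} : Var Γ A → Var (B :: Γ) A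

/-- Well-typed `λ`-terms of type `A` in the context `Γ`.  `mvar n : Term Γ A` is the unification
variable with name `n` and type `A` (there are infinitely many of each type). It stands for a term
of the ambient context of the problem and is not affected by `β`-reduction. -/
inductive Term {ι : Type u} : Ctx ι → Ty ι → Type u
  | var {Γ : Ctx ι} {A : Ty ι} : Var Γ A → Term Γ A
  | mvar {Γ : Ctx ι} {A : Ty ι} : ℕ → Term Γ A
  | app {Γ : Ctx ι} {A B : Ty ι} : Term Γ (.arr A B) → Term Γ A → Term Γ B
  | lam {Γ : Ctx ι} {A B : Ty ι} : Term (A :: Γ) B → Term Γ (.arr A B)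

def liftRen {ι : Type u} {Γ Δ : Ctx ι} (ρ : ∀ A, Var Γ A → Var Δ A) (B : Ty ι) :
    ∀ A, Var (B :: Γ) A → Var (B :: Δ) A
  | _, .zero => .zero
  | _, .succ x => .succ (ρ _ x)

def Term.rename {ι : Type u} {Γ : Ctx ι} {A : Ty ι} :
    Term Γ A → {Δ : Ctx ι} → (∀ A, Var Γ A → Var Δ A) → Term Δ A
  | .var x, _, ρ => .var (ρ _ x)
  | .mvar n, _, _ => .mvar n
  | .app a b, _, ρ => .app (a.rename ρ) (b.rename ρ)
  | .lam a, _, ρ => .lam (a.rename (liftRen ρ _))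

/-- The lifting `a⁺`. -/
def Term.weaken {ι : Type u} {Γ : Ctx ι} {A : Ty ι} (B : Ty ι) (a : Term Γ A) :
    Term (B :: Γ) A :=
  a.rename fun _ x => .succ x

def liftSub {ι : Type u} {Γ Δ : Ctx ι} (τ : ∀ A, Var Γ A → Term Δ A) (B : Ty ι) :
    ∀ A, Var (B :: Γ) A → Term (B :: Δ) A
  | _, .zero => .var .zero
  | _, .succ x => (τ _ x).weaken B

/-- Simultaneous capture-avoiding substitution for the de Bruijn indices. -/
def Term.subst {ι : Type u} {Γ : Ctx ι} {A : Ty ι} :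
    Term Γ A → {Δ : Ctx ι} → (∀ A, Var Γ A → Term Δ A) → Term Δ A
  | .var x, _, τ => τ _ x
  | .mvar n, _, _ => .mvar n
  | .app a b, _, τ => .app (a.subst τ) (b.subst τ)
  | .lam a, _, τ => .lam (a.subst (liftSub τ _))

def single {ι : Type u} {Γ : Ctx ι} {B : Ty ι} (b : Term Γ B) : ∀ A, Var (B :: Γ) A → Term Γ A
  | _, .zero => b
  | _, .succ x => .var x

/-- One step of `βη`-reduction. -/
inductive BetaEta {ι : Type u} : {Γ : Ctx ι} → {A : Ty ι} → Term Γ A → Term Γ A → Prop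
  | beta {Γ : Ctx ι} {A B : Ty ι} (a : Term (A :: Γ) B) (b : Term Γ A) :
      BetaEta (.app (.lam a) b) (a.subst (single b))
  | eta {Γ : Ctx ι} {A B : Ty ι} (a : Term Γ (.arr A B)) :
      BetaEta (.lam (.app (a.weaken A) (.var .zero))) a
  | appL {Γ : Ctx ι} {A B : Ty ι} {a a' : Term Γ (.arr A B)} (b : Term Γ A) :
      BetaEta a a' → BetaEta (.app a b) (.app a' b)
  | appR {Γ : Ctx ι} {A B : Ty ι} (a : Term Γ (.arr A B)) {b b' : Term Γ A} :
      BetaEta b b' → BetaEta (.app a b) (.app a b')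
  | lam {Γ : Ctx ι} {A B : Ty ι} {a a' : Term (A :: Γ) B} :
      BetaEta a a' → BetaEta (.lam a) (.lam a')

/-- `βη`-equality of `λ`-terms. -/
def BetaEtaConv {ι : Type u} {Γ : Ctx ι} {A : Ty ι} (a b : Term Γ A) : Prop :=
  Relation.EqvGen BetaEta a b

/-- `Wk Δ Γ`: `Δ` is obtained from `Γ` by adding types in front; `Δ` is the local context below
the binders crossed so far, inside a term of context `Γ`. -/
inductive Wk {ι : Type u} (Γ : Ctx ι) : Ctx ι → Type u
  | nil : Wk Γ Γ
  | cons {Δ : Ctx ι} {A : Ty ι} : Wk Γ Δ → Wk Γ (A :: Δ)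

def Wk.ren {ι : Type u} {Γ Δ : Ctx ι} : Wk Γ Δ → ∀ A, Var Γ A → Var Δ A
  | .nil, _, x => x
  | .cons w, _, x => .succ (w.ren _ x)

/-- Application of a substitution `θ` of terms of context `Γ` for the unification variables of a
term; `θ` is lifted whenever a binder is crossed, so there is no capture. -/
def Term.inst {ι : Type u} {Γ : Ctx ι} (θ : ∀ A : Ty ι, ℕ → Term Γ A) {Δ : Ctx ι} {A : Ty ι} :
    Term Δ A → Wk Γ Δ → Term Δ A
  | .var x, _ => .var x
  | .mvar n, w => (θ _ n).rename w.ren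
  | .app a b, w => .app (a.inst θ w) (b.inst θ w)
  | .lam a, w => .lam (a.inst θ (.cons w))

/-- The unification problem `a = b` of the `λ`-calculus, in the context `Γ`, has a solution. -/
def HasSolution {ι : Type u} {Γ : Ctx ι} {T : Ty ι} (a b : Term Γ T) : Prop :=
  ∃ θ : ∀ A : Ty ι, ℕ → Term Γ A, BetaEtaConv (a.inst θ .nil) (b.inst θ .nil)

/-! ### The simply typed `λσ`-calculus with unification variables of the sort of terms -/

/-- In a context, an expression is either a term of some type or an explicit substitution with
some codomain context. -/
inductive Kind (ι : Type u) : Type u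
  | tm : Ty ι → Kind ι
  | sub : Ctx ι → Kind ι

/-- Well-typed expressions of the `λσ`-calculus.  `Expr Γ (.tm A)` are the terms `a` with
`Γ ⊢ a : A` and `Expr Γ (.sub Δ)` the substitutions `s` with `Γ ⊢ s ▷ Δ`.
`mvar n : Expr Γ (.tm A)` is the unification variable with name `n` and sort `(Γ, A)`
(there are infinitely many of each sort). -/
inductive Expr {ι : Type u} : Ctx ι → Kind ι → Type u
  /-- the index `1` -/
  | one {Γ : Ctx ι} {A : Ty ι} : Expr (A :: Γ) (.tm A)
  | mvar {Γ : Ctx ι} {A : Ty ι} : ℕ → Expr Γ (.tm A)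
  | app {Γ : Ctx ι} {A B : Ty ι} :
      Expr Γ (.tm (.arr A B)) → Expr Γ (.tm A) → Expr Γ (.tm B)
  | lam {Γ : Ctx ι} {A B : Ty ι} : Expr (A :: Γ) (.tm B) → Expr Γ (.tm (.arr A B))
  /-- the closure `a[s]` -/
  | clos {Γ Δ : Ctx ι} {A : Ty ι} : Expr Δ (.tm A) → Expr Γ (.sub Δ) → Expr Γ (.tm A)
  | id {Γ : Ctx ι} : Expr Γ (.sub Γ)
  /-- the shift `↑` -/
  | shift {Γ : Ctx ι} {A : Ty ι} : Expr (A :: Γ) (.sub Γ)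
  /-- `a.s` -/
  | cons {Γ Δ : Ctx ι} {A : Ty ι} :
      Expr Γ (.tm A) → Expr Γ (.sub Δ) → Expr Γ (.sub (A :: Δ))
  /-- `s ∘ t` (first `s`, then `t`) -/
  | comp {Γ Δ Θ : Ctx ι} : Expr Δ (.sub Θ) → Expr Γ (.sub Δ) → Expr Γ (.sub Θ)

/-- The rules of `σ`. -/
inductive SigmaRule {ι : Type u} : (Γ : Ctx ι) → (k : Kind ι) → Expr Γ k → Expr Γ k → Prop
  | app {Γ Δ : Ctx ι} {A B : Ty ι} (a : Expr Δ (.tm (.arr A B))) (b : Expr Δ (.tm A))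
      (s : Expr Γ (.sub Δ)) :
      SigmaRule _ _ (.clos (.app a b) s) (.app (.clos a s) (.clos b s))
  | varCons {Γ Δ : Ctx ι} {A : Ty ι} (a : Expr Γ (.tm A)) (s : Expr Γ (.sub Δ)) :
      SigmaRule _ _ (.clos .one (.cons a s)) a
  | id {Γ : Ctx ι} {A : Ty ι} (a : Expr Γ (.tm A)) : SigmaRule _ _ (.clos a .id) a
  | abs {Γ Δ : Ctx ι} {A B : Ty ι} (a : Expr (A :: Δ) (.tm B)) (s : Expr Γ (.sub Δ)) :
      SigmaRule _ _ (.clos (.lam a) s) (.lam (.clos a (.cons .one (.comp s .shift))))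
  | clos {Γ Δ Θ : Ctx ι} {A : Ty ι} (a : Expr Θ (.tm A)) (s : Expr Δ (.sub Θ))
      (t : Expr Γ (.sub Δ)) :
      SigmaRule _ _ (.clos (.clos a s) t) (.clos a (.comp s t))
  | idL {Γ Δ : Ctx ι} (s : Expr Γ (.sub Δ)) : SigmaRule _ _ (.comp .id s) s
  | idR {Γ Δ : Ctx ι} (s : Expr Γ (.sub Δ)) : SigmaRule _ _ (.comp s .id) s
  | shiftCons {Γ Δ : Ctx ι} {A : Ty ι} (a : Expr Γ (.tm A)) (s : Expr Γ (.sub Δ)) :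
      SigmaRule _ _ (.comp .shift (.cons a s)) s
  | assEnv {Γ Δ Θ Ξ : Ctx ι} (s : Expr Θ (.sub Ξ)) (t : Expr Δ (.sub Θ))
      (r : Expr Γ (.sub Δ)) :
      SigmaRule _ _ (.comp (.comp s t) r) (.comp s (.comp t r))
  | mapEnv {Γ Δ Θ : Ctx ι} {A : Ty ι} (a : Expr Δ (.tm A)) (s : Expr Δ (.sub Θ))
      (t : Expr Γ (.sub Δ)) :
      SigmaRule _ _ (.comp (.cons a s) t) (.cons (.clos a t) (.comp s t))
  | varShift {Γ : Ctx ι} {A : Ty ι} :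
      SigmaRule (A :: Γ) (.sub (A :: Γ)) (.cons .one .shift) .id
  | sCons {Γ Δ : Ctx ι} {A : Ty ι} (s : Expr Γ (.sub (A :: Δ))) :
      SigmaRule _ _ (.cons (.clos .one s) (.comp .shift s)) s

/-- One-step rewriting at an arbitrary position, by the rules `R`. -/
inductive Step {ι : Type u} (R : (Γ : Ctx ι) → (k : Kind ι) → Expr Γ k → Expr Γ k → Prop) :
    {Γ : Ctx ι} → {k : Kind ι} → Expr Γ k → Expr Γ k → Prop
  | root {Γ : Ctx ι} {k : Kind ι} {e e' : Expr Γ k} : R Γ k e e' → Step R e e'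
  | appL {Γ : Ctx ι} {A B : Ty ι} {a a' : Expr Γ (.tm (.arr A B))} (b : Expr Γ (.tm A)) :
      Step R a a' → Step R (.app a b) (.app a' b)
  | appR {Γ : Ctx ι} {A B : Ty ι} (a : Expr Γ (.tm (.arr A B))) {b b' : Expr Γ (.tm A)} :
      Step R b b' → Step R (.app a b) (.app a b')
  | lam {Γ : Ctx ι} {A B : Ty ι} {a a' : Expr (A :: Γ) (.tm B)} :
      Step R a a' → Step R (.lam a) (.lam a')
  | closL {Γ Δ : Ctx ι} {A : Ty ι} {a a' : Expr Δ (.tm A)} (s : Expr Γ (.sub Δ)) :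
      Step R a a' → Step R (.clos a s) (.clos a' s)
  | closR {Γ Δ : Ctx ι} {A : Ty ι} (a : Expr Δ (.tm A)) {s s' : Expr Γ (.sub Δ)} :
      Step R s s' → Step R (.clos a s) (.clos a s')
  | consL {Γ Δ : Ctx ι} {A : Ty ι} {a a' : Expr Γ (.tm A)} (s : Expr Γ (.sub Δ)) :
      Step R a a' → Step R (.cons a s) (.cons a' s)
  | consR {Γ Δ : Ctx ι} {A : Ty ι} (a : Expr Γ (.tm A)) {s s' : Expr Γ (.sub Δ)} :
      Step R s s' → Step R (.cons a s) (.cons a s')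
  | compL {Γ Δ Θ : Ctx ι} {s s' : Expr Δ (.sub Θ)} (t : Expr Γ (.sub Δ)) :
      Step R s s' → Step R (.comp s t) (.comp s' t)
  | compR {Γ Δ Θ : Ctx ι} (s : Expr Δ (.sub Θ)) {t t' : Expr Γ (.sub Δ)} :
      Step R t t' → Step R (.comp s t) (.comp s t')

/-- `σ`-equality. -/
def SigmaConv {ι : Type u} {Γ : Ctx ι} {k : Kind ι} (e e' : Expr Γ k) : Prop :=
  Relation.EqvGen (Step SigmaRule) e e'

/-- The rules of `λσ`: those of `σ`, Beta and Eta. -/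
inductive LambdaSigmaRule {ι : Type u} :
    (Γ : Ctx ι) → (k : Kind ι) → Expr Γ k → Expr Γ k → Prop
  | sigma {Γ : Ctx ι} {k : Kind ι} {e e' : Expr Γ k} :
      SigmaRule Γ k e e' → LambdaSigmaRule Γ k e e'
  | beta {Γ : Ctx ι} {A B : Ty ι} (a : Expr (A :: Γ) (.tm B)) (b : Expr Γ (.tm A)) :
      LambdaSigmaRule _ _ (.app (.lam a) b) (.clos a (.cons b .id))
  | eta {Γ : Ctx ι} {A B : Ty ι} (a : Expr (A :: Γ) (.tm (.arr A B)))
      (b : Expr Γ (.tm (.arr A B))) :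
      SigmaConv a (.clos b .shift) → LambdaSigmaRule _ _ (.lam (.app a .one)) b

/-- `λσ`-equality. -/
def LambdaSigmaConv {ι : Type u} {Γ : Ctx ι} {k : Kind ι} (e e' : Expr Γ k) : Prop :=
  Relation.EqvGen (Step LambdaSigmaRule) e e'

/-- `e'` is a `λσ`-normal form of `e`. -/
def IsNormalForm {ι : Type u} {Γ : Ctx ι} {k : Kind ι} (e e' : Expr Γ k) : Prop :=
  Relation.ReflTransGen (Step LambdaSigmaRule) e e' ∧ ∀ e'', ¬ Step LambdaSigmaRule e' e''

/-- `e` is irreducible for `σ`. -/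
def IsSigmaNormal {ι : Type u} {Γ : Ctx ι} {k : Kind ι} (e : Expr Γ k) : Prop :=
  ∀ e', ¬ Step SigmaRule e e'

/-- A substitution for the unification variables, mapping every variable of sort `(Γ, A)` to a
term of type `A` in `Γ`. -/
abbrev Grafting (ι : Type u) : Type u := ∀ (Γ : Ctx ι) (A : Ty ι), ℕ → Expr Γ (.tm A)

/-- Replacement of the unification variables (first-order: explicit substitutions take care of
the binders). -/
def Expr.graft {ι : Type u} (θ : Grafting ι) {Γ : Ctx ι} {k : Kind ι} : Expr Γ k → Expr Γ k
  | .one => .one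
  | .mvar n => θ _ _ n
  | .app a b => .app (a.graft θ) (b.graft θ)
  | .lam a => .lam (a.graft θ)
  | .clos a s => .clos (a.graft θ) (s.graft θ)
  | .id => .id
  | .shift => .shift
  | .cons a s => .cons (a.graft θ) (s.graft θ)
  | .comp s t => .comp (s.graft θ) (t.graft θ)

/-- `θ` is a solution of the `λσ`-unification problem `a = b`. -/
def Solves {ι : Type u} {Γ : Ctx ι} {T : Ty ι} (θ : Grafting ι) (a b : Expr Γ (.tm T)) : Prop :=
  LambdaSigmaConv (a.graft θ) (b.graft θ)

/-- `IsShiftPow n s`: the substitution `s` is `↑ⁿ`, where `↑⁰ = id`, `↑¹ = ↑` and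
`↑ⁿ⁺¹ = ↑ ∘ ↑ⁿ`. -/
inductive IsShiftPow {ι : Type u} : ℕ → {Γ Δ : Ctx ι} → Expr Γ (.sub Δ) → Prop
  | zero {Γ : Ctx ι} : IsShiftPow 0 (.id : Expr Γ (.sub Γ))
  | one {Γ : Ctx ι} {A : Ty ι} : IsShiftPow 1 (.shift : Expr (A :: Γ) (.sub Γ))
  | succ {n : ℕ} {Γ Δ : Ctx ι} {A : Ty ι} {s : Expr Γ (.sub (A :: Δ))} :
      IsShiftPow (n + 1) s → IsShiftPow (n + 2) (.comp .shift s)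

def Expr.IsMVar {ι : Type u} {Γ : Ctx ι} {k : Kind ι} : Expr Γ k → Prop
  | .mvar _ => True
  | _ => False

/-- An expression is simple if each of its subterms `X[s]`, with `X` a unification variable, is
such that `s = ↑ⁿ` for some `n`. -/
def Expr.IsSimple {ι : Type u} {Γ : Ctx ι} {k : Kind ι} : Expr Γ k → Prop
  | .one => True
  | .mvar _ => True
  | .app a b => a.IsSimple ∧ b.IsSimple
  | .lam a => a.IsSimple
  | .clos a s => (a.IsMVar → ∃ n, IsShiftPow n s) ∧ a.IsSimple ∧ s.IsSimple
  | .id => True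
  | .shift => True
  | .cons a s => a.IsSimple ∧ s.IsSimple
  | .comp s t => s.IsSimple ∧ t.IsSimple

/-- A substitution for the unification variables is simple if all its values are. -/
def Grafting.IsSimple {ι : Type u} (θ : Grafting ι) : Prop :=
  ∀ (Γ : Ctx ι) (A : Ty ι) (n : ℕ), (θ Γ A n).IsSimple

/-- A unification variable of the `λσ`-calculus: a name and a sort `(ctx, ty)`. -/
structure MVar (ι : Type u) : Type u where
  name : ℕ
  ctx : Ctx ι
  ty : Ty ι

/-- The unification variables that occur in an expression. -/
def Expr.mvars {ι : Type u} {Γ : Ctx ι} {k : Kind ι} : Expr Γ k → Set (MVar ι)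
  | .one => ∅
  | .mvar (Γ := Γ) (A := A) n => {⟨n, Γ, A⟩}
  | .app a b => a.mvars ∪ b.mvars
  | .lam a => a.mvars
  | .clos a s => a.mvars ∪ s.mvars
  | .id => ∅
  | .shift => ∅
  | .cons a s => a.mvars ∪ s.mvars
  | .comp s t => s.mvars ∪ t.mvars

/-! ### Precooking -/

/-- The index `1 + k` of a context `Γ`, read through `s`: the term `1[↑ᵏ ∘ s]`. -/
def varShift {ι : Type u} {Γ : Ctx ι} {A : Ty ι} :
    Var Γ A → {Θ : Ctx ι} → Expr Θ (.sub Γ) → Expr Θ (.tm A)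
  | .zero, _, s => .clos .one s
  | .succ x, _, s => varShift x (.comp .shift s)

/-- The index `1 + k` as the `λσ`-term `1[↑ᵏ]`, with `1[↑⁰] = 1`. -/
def precookVar {ι : Type u} {Γ : Ctx ι} {A : Ty ι} : Var Γ A → Expr Γ (.tm A)
  | .zero => .one
  | .succ x => varShift x .shift

/-- For `Δ` that extends `Γ` by `n` types, the substitution `↑ⁿ ∘ s`, nested to the right. -/
def wkShift {ι : Type u} {Γ Δ : Ctx ι} : Wk Γ Δ → {Θ : Ctx ι} → Expr Θ (.sub Δ) → Expr Θ (.sub Γ)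
  | .nil, _, s => s
  | .cons w, _, s => wkShift w (.comp .shift s)

/-- The unification variable of name `m` and sort `(Γ, A)` below `n` binders: the term `X[↑ⁿ]`,
with `X[↑⁰] = X`. -/
def precookMVar {ι : Type u} {Γ Δ : Ctx ι} {A : Ty ι} (m : ℕ) : Wk Γ Δ → Expr Δ (.tm A)
  | .nil => .mvar m
  | .cons w => .clos (.mvar m : Expr Γ (.tm A)) (wkShift w .shift)

/-- Precooking `F`, with the binders crossed so far as an argument. -/
def precookAux {ι : Type u} {Γ Δ : Ctx ι} {A : Ty ι} : Term Δ A → Wk Γ Δ → Expr Δ (.tm A)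
  | .var x, _ => precookVar x
  | .mvar m, w => precookMVar m w
  | .app a b, w => .app (precookAux a w) (precookAux b w)
  | .lam a, w => .lam (precookAux a (.cons w))

/-- The precooking `a_F` of a `λ`-term `a` of context `Γ`; a unification variable of type `A` becomes
one of sort `(Γ, A)`. -/
def precook {ι : Type u} {Γ : Ctx ι} {A : Ty ι} (a : Term Γ A) : Expr Γ (.tm A) :=
  precookAux a .nil

/-! ### The substitution `X ↦ λ ⋯ λ Y` -/

/-- For `A = A₁ → ⋯ → Aₙ → B` with `B` atomic, the term `λ_{A₁} ⋯ λ_{Aₙ} c`. -/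
def lams {ι : Type u} : (A : Ty ι) → {Γ : Ctx ι} →
    Expr (A.bodyCtx Γ) (.tm (.base A.target)) → Expr Γ (.tm A)
  | .base _, _, c => c
  | .arr _ B, _, c => .lam (lams B c)

/-- For `X` of sort `(Γ, A₁ → ⋯ → Aₙ → B)` with `B` atomic, the variable `Y` of sort
`(Aₙ. ⋯ .A₁.Γ, B)` whose name is `y X`. -/
def bodyVar {ι : Type u} (y : MVar ι → ℕ) (X : MVar ι) : MVar ι :=
  ⟨y X, X.ty.bodyCtx X.ctx, .base X.ty.target⟩

/-- The choice `y` of names gives new and pairwise distinct variables to the elements of `V`. -/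
def IsFresh {ι : Type u} (y : MVar ι → ℕ) (V : Set (MVar ι)) : Prop :=
  Set.InjOn (bodyVar y) V ∧ ∀ X ∈ V, bodyVar y X ∉ V

open Classical in
/-- The substitution that maps each variable `X` in `V` to `λ ⋯ λ Y` with `Y = bodyVar y X`, and
each other variable to itself. -/
noncomputable def expand {ι : Type u} (y : MVar ι → ℕ) (V : Set (MVar ι)) : Grafting ι :=
  fun Γ A n => if (⟨n, Γ, A⟩ : MVar ι) ∈ V then lams A (.mvar (y ⟨n, Γ, A⟩)) else .mvar n

end LambdaSigma

open LambdaSigma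

/-!
Performing the explicit substitutions of a `λσ`-expression gives a `λ`-term. This evaluation maps
`λσ`-equality to `βη`-equality, and grafting into a precooked term to instantiation of the original
term. Hence every solution of `ã = b̃`, simple or not, evaluates to a solution of `a = b`.

Conversely, precooking maps `βη`-equality to `λσ`-equality, because it commutes with the
substitution of de Bruijn indices. If `τ` solves `a = b`, then `ã = b̃` is solved by mapping `Y_X`
to the precooking of `(τ X) n ⋯ 1`, the body of the `η`-expansion of `τ X`, where `Y_X` stands
below the `n` new binders; and precooked terms are simple and `σ`-normal.
-/

namespace LambdaSigma

universe u

variable {ι : Type u} {Γ Δ Θ : Ctx ι} {A B : Ty ι} {k : Kind ι}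

/-! ### Renaming and substitution of de Bruijn indices -/

/-- Renamings of the de Bruijn indices of `Γ` by those of `Δ`. -/
abbrev Ren (Γ Δ : Ctx ι) : Type u := ∀ A, Var Γ A → Var Δ A

/-- Simultaneous substitutions of terms of context `Δ` for the de Bruijn indices of `Γ`. -/
abbrev Subst (Γ Δ : Ctx ι) : Type u := ∀ A, Var Γ A → Term Δ A

theorem liftRen_comp (ρ : Ren Γ Δ) (ρ' : Ren Δ Θ) (B : Ty ι) :
    (fun A x => liftRen ρ' B A (liftRen ρ B A x)) = liftRen (fun A x => ρ' A (ρ A x)) B := by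
  funext A x; cases x <;> rfl

theorem Term.rename_rename (a : Term Γ A) (ρ : Ren Γ Δ) (ρ' : Ren Δ Θ) :
    (a.rename ρ).rename ρ' = a.rename fun A x => ρ' A (ρ A x) := by
  induction a generalizing Δ Θ with
  | var | mvar => rfl
  | app a b iha ihb => simp only [rename, iha, ihb]
  | lam a ih => simp only [rename, ih, liftRen_comp]

theorem liftSub_liftRen (ρ : Ren Γ Δ) (τ : Subst Δ Θ) (B : Ty ι) :
    (fun A x => liftSub τ B A (liftRen ρ B A x)) = liftSub (fun A x => τ A (ρ A x)) B := by
  funext A x; cases x <;> rfl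

theorem Term.subst_rename (a : Term Γ A) (ρ : Ren Γ Δ) (τ : Subst Δ Θ) :
    (a.rename ρ).subst τ = a.subst fun A x => τ A (ρ A x) := by
  induction a generalizing Δ Θ with
  | var | mvar => rfl
  | app a b iha ihb => simp only [rename, subst, iha, ihb]
  | lam a ih => simp only [rename, subst, ih, liftSub_liftRen]

theorem rename_liftSub (τ : Subst Γ Δ) (ρ : Ren Δ Θ) (B : Ty ι) :
    (fun A x => (liftSub τ B A x).rename (liftRen ρ B)) =
      liftSub (fun A x => (τ A x).rename ρ) B := by
  funext A x
  cases x with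
  | zero => rfl
  | succ x => simp only [liftSub, Term.weaken, Term.rename_rename, liftRen]

theorem Term.rename_subst (a : Term Γ A) (τ : Subst Γ Δ) (ρ : Ren Δ Θ) :
    (a.subst τ).rename ρ = a.subst fun A x => (τ A x).rename ρ := by
  induction a generalizing Δ Θ with
  | var | mvar => rfl
  | app a b iha ihb => simp only [rename, subst, iha, ihb]
  | lam a ih => simp only [rename, subst, ih, rename_liftSub]

theorem Term.weaken_subst (a : Term Γ A) (τ : Subst Γ Δ) (B : Ty ι) :
    (a.weaken B).subst (liftSub τ B) = (a.subst τ).weaken B := by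
  simp only [weaken, subst_rename, rename_subst, liftSub]

theorem subst_liftSub (τ : Subst Γ Δ) (τ' : Subst Δ Θ) (B : Ty ι) :
    (fun A x => (liftSub τ B A x).subst (liftSub τ' B)) =
      liftSub (fun A x => (τ A x).subst τ') B := by
  funext A x
  cases x with
  | zero => rfl
  | succ x => simp only [liftSub, Term.weaken_subst]

theorem Term.subst_subst (a : Term Γ A) (τ : Subst Γ Δ) (τ' : Subst Δ Θ) :
    (a.subst τ).subst τ' = a.subst fun A x => (τ A x).subst τ' := by
  induction a generalizing Δ Θ with
  | var | mvar => rfl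
  | app a b iha ihb => simp only [subst, iha, ihb]
  | lam a ih => simp only [subst, ih, subst_liftSub]

theorem liftSub_var_ren (ρ : Ren Γ Δ) (B : Ty ι) :
    liftSub (fun A x => .var (ρ A x)) B = fun A x => .var (liftRen ρ B A x) := by
  funext A x; cases x <;> rfl

theorem Term.rename_eq_subst (a : Term Γ A) (ρ : Ren Γ Δ) :
    a.rename ρ = a.subst fun A x => .var (ρ A x) := by
  induction a generalizing Δ with
  | var | mvar => rfl
  | app a b iha ihb => simp only [rename, subst, iha, ihb]
  | lam a ih => simp only [rename, subst, ih, liftSub_var_ren]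

theorem liftSub_var (B : Ty ι) :
    liftSub (fun A (x : Var Γ A) => .var x) B = fun _ x => .var x := by
  funext A x; cases x <;> rfl

theorem Term.subst_var (a : Term Γ A) : (a.subst fun _ x => .var x) = a := by
  induction a with
  | var | mvar => rfl
  | app a b iha ihb => simp only [subst, iha, ihb]
  | lam a ih => simp only [subst, liftSub_var, ih]

theorem Term.rename_id (a : Term Γ A) : (a.rename fun _ x => x) = a := by
  rw [rename_eq_subst, subst_var]

theorem Term.subst_liftSub_subst_single (a : Term (A :: Γ) B) (b : Term Γ A) (τ : Subst Γ Δ) :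
    (a.subst (liftSub τ A)).subst (single (b.subst τ)) = (a.subst (single b)).subst τ := by
  simp only [subst_subst]
  congr 1
  funext C x
  cases x with
  | zero => rfl
  | succ x => simp only [liftSub, single, weaken, subst_rename, subst, subst_var]

/-! ### `βη`-equality -/

theorem eqvGen_map {α β : Type*} {r : α → α → Prop} {r' : β → β → Prop} (f : α → β)
    (hf : ∀ x y, r x y → r' (f x) (f y)) {x y : α} (h : Relation.EqvGen r x y) :
    Relation.EqvGen r' (f x) (f y) :=
  Setoid.eqvGen_le (s := (Relation.EqvGen.setoid r').comap f) (fun _ _ h => .rel _ _ (hf _ _ h)) h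

theorem BetaEtaConv.app {a a' : Term Γ (.arr A B)} {b b' : Term Γ A}
    (ha : BetaEtaConv a a') (hb : BetaEtaConv b b') : BetaEtaConv (.app a b) (.app a' b') :=
  .trans _ _ _ (eqvGen_map (Term.app · b) (fun _ _ => .appL b) ha)
    (eqvGen_map (Term.app a') (fun _ _ => .appR a') hb)

theorem BetaEtaConv.lam {a a' : Term (A :: Γ) B} (ha : BetaEtaConv a a') :
    BetaEtaConv (.lam a) (.lam a') :=
  eqvGen_map Term.lam (fun _ _ => .lam) ha

theorem BetaEta.subst {a a' : Term Γ A} (h : BetaEta a a') (τ : Subst Γ Δ) :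
    BetaEta (a.subst τ) (a'.subst τ) := by
  induction h generalizing Δ with
  | beta a b =>
    rw [← Term.subst_liftSub_subst_single]
    exact .beta _ _
  | eta a =>
    simp only [Term.subst, Term.weaken_subst]
    exact .eta _
  | appL b _ ih => exact .appL _ (ih τ)
  | appR a _ ih => exact .appR _ (ih τ)
  | lam _ ih => exact .lam (ih _)

theorem BetaEtaConv.subst_left {a a' : Term Γ A} (h : BetaEtaConv a a') (τ : Subst Γ Δ) :
    BetaEtaConv (a.subst τ) (a'.subst τ) :=
  eqvGen_map (fun a : Term Γ A => a.subst τ) (fun _ _ h => h.subst τ) h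

theorem BetaEtaConv.weaken {a a' : Term Γ A} (h : BetaEtaConv a a') (B : Ty ι) :
    BetaEtaConv (a.weaken B) (a'.weaken B) := by
  simp only [Term.weaken, Term.rename_eq_subst]
  exact h.subst_left _

theorem BetaEtaConv.subst_right (a : Term Γ A) {τ τ' : Subst Γ Δ}
    (h : ∀ A x, BetaEtaConv (τ A x) (τ' A x)) : BetaEtaConv (a.subst τ) (a.subst τ') := by
  induction a generalizing Δ with
  | var x => exact h _ x
  | mvar n => exact .refl _
  | app a b iha ihb => exact (iha h).app (ihb h)
  | lam a ih =>
    refine (ih fun A x => ?_).lam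
    cases x with
    | zero => exact .refl _
    | succ x => exact (h _ x).weaken _

/-! ### Evaluation of `λσ`-expressions -/

/-- The values of the expressions of kind `k` in `Γ`: terms for the kind of terms, simultaneous
substitutions for the kind of explicit substitutions. -/
abbrev Kind.Value (Γ : Ctx ι) : Kind ι → Type u
  | .tm A => Term Γ A
  | .sub Δ => Subst Δ Γ

/-- The simultaneous substitution `b.τ`: the index `1` is mapped to `b`, and `n + 1` to the image
of `n` under `τ`. -/
def consSub (b : Term Γ B) (τ : Subst Δ Γ) : Subst (B :: Δ) Γ
  | _, .zero => b
  | _, .succ x => τ _ x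

/-- The result of performing the explicit substitutions of an expression. A unification variable
of sort `(Γ, A)` becomes the unification variable of the `λ`-calculus with the same name and
type; the context `Γ` is forgotten. -/
def Expr.eval {Γ : Ctx ι} {k : Kind ι} : Expr Γ k → k.Value Γ
  | .one => Term.var .zero
  | .mvar n => Term.mvar n
  | .app a b => Term.app a.eval b.eval
  | .lam a => Term.lam a.eval
  | .clos a s => Term.subst a.eval s.eval
  | .id => fun _ x => .var x
  | .shift => fun _ x => .var (.succ x)
  | .cons a s => consSub a.eval s.eval
  | .comp s t => fun _ x => (s.eval _ x).subst t.eval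

theorem consSub_var_zero_shift (τ : Subst Γ Δ) :
    consSub (.var .zero) (fun A x => (τ A x).subst fun _ y => .var (.succ y)) = liftSub τ B := by
  funext A x
  cases x with
  | zero => rfl
  | succ x => simp only [consSub, liftSub, Term.weaken, Term.rename_eq_subst]

theorem consSub_var (b : Term Γ B) : consSub b (fun _ x => .var x) = single b := by
  funext A x; cases x <;> rfl

theorem SigmaRule.eval_eq {e e' : Expr Γ k} (h : SigmaRule Γ k e e') : e.eval = e'.eval := by
  cases h with
  | app | varCons | idL | shiftCons => rfl
  | id | idR => simp only [Expr.eval, Term.subst_var]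
  | abs a s => simp only [Expr.eval, Term.subst, consSub_var_zero_shift]
  | clos | assEnv => simp only [Expr.eval, Term.subst_subst]
  | mapEnv | varShift | sCons => funext A x; cases x <;> rfl

theorem Step.eval_eq {e e' : Expr Γ k} (h : Step SigmaRule e e') : e.eval = e'.eval := by
  induction h with
  | root h => exact h.eval_eq
  | _ => simp only [Expr.eval, *]

theorem SigmaConv.eval_eq {e e' : Expr Γ k} (h : SigmaConv e e') : e.eval = e'.eval :=
  Setoid.eqvGen_le (s := Setoid.ker Expr.eval) (fun _ _ h => h.eval_eq) h

/-- `βη`-equality of terms. -/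
instance betaEtaSetoid : Setoid (Term Γ A) := Relation.EqvGen.setoid BetaEta

/-- `βη`-equality of values, pointwise on simultaneous substitutions. -/
instance Kind.valueSetoid : (k : Kind ι) → Setoid (k.Value Γ)
  | .tm A => inferInstanceAs (Setoid (Term Γ A))
  | .sub Δ => inferInstanceAs (Setoid (Subst Δ Γ))

theorem LambdaSigmaRule.eval_equiv {e e' : Expr Γ k} (h : LambdaSigmaRule Γ k e e') :
    e.eval ≈ e'.eval := by
  cases h with
  | sigma h => rw [h.eval_eq]
  | beta a b =>
    simp only [Expr.eval, consSub_var]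
    exact .rel _ _ (.beta _ _)
  | eta a b h =>
    have ha : a.eval = Term.weaken _ b.eval := h.eval_eq.trans (Term.rename_eq_subst _ _).symm
    simp only [Expr.eval, ha]
    exact .rel _ _ (.eta _)

theorem Step.eval_equiv {e e' : Expr Γ k} (h : Step LambdaSigmaRule e e') :
    e.eval ≈ e'.eval := by
  induction h with
  | root h => exact h.eval_equiv
  | appL b _ ih => exact BetaEtaConv.app ih (.refl _)
  | appR a _ ih => exact BetaEtaConv.app (.refl _) ih
  | lam _ ih => exact BetaEtaConv.lam ih
  | closL s _ ih => exact BetaEtaConv.subst_left ih _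
  | closR a _ ih => exact BetaEtaConv.subst_right _ ih
  | consL s _ ih =>
    intro A x
    cases x with
    | zero => exact ih
    | succ x => exact .refl _
  | consR a _ ih =>
    intro A x
    cases x with
    | zero => exact .refl _
    | succ x => exact ih _ x
  | compL t _ ih => exact fun A x => BetaEtaConv.subst_left (ih A x) _
  | compR s _ ih => exact fun A x => BetaEtaConv.subst_right _ ih

theorem LambdaSigmaConv.eval_equiv {e e' : Expr Γ k} (h : LambdaSigmaConv e e') :
    e.eval ≈ e'.eval :=
  Setoid.eqvGen_le (s := (Kind.valueSetoid k).comap Expr.eval) (fun _ _ h => h.eval_equiv) h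

theorem eval_varShift (x : Var Γ A) (s : Expr Θ (.sub Γ)) :
    (varShift x s).eval = s.eval A x := by
  induction x generalizing Θ with
  | zero => rfl
  | succ _ ih => exact ih _

theorem eval_precookVar (x : Var Γ A) : (precookVar x).eval = Term.var x := by
  cases x with
  | zero => rfl
  | succ x => exact eval_varShift _ _

theorem eval_wkShift (w : Wk Γ Δ) (s : Expr Θ (.sub Δ)) :
    (wkShift w s).eval = fun A x => s.eval A (w.ren A x) := by
  induction w generalizing Θ with
  | nil => rfl
  | cons _ ih => exact ih _

/-! ### Grafting -/

theorem SigmaRule.graft (θ : Grafting ι) {e e' : Expr Γ k} (h : SigmaRule Γ k e e') :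
    SigmaRule Γ k (e.graft θ) (e'.graft θ) := by
  cases h <;> constructor

theorem Step.graft {R : (Γ : Ctx ι) → (k : Kind ι) → Expr Γ k → Expr Γ k → Prop} {θ : Grafting ι}
    (hR : ∀ {Γ k} {e e' : Expr Γ k}, R Γ k e e' → R Γ k (e.graft θ) (e'.graft θ))
    {e e' : Expr Γ k} (h : Step R e e') : Step R (e.graft θ) (e'.graft θ) := by
  induction h with
  | root h => exact .root (hR h)
  | appL b _ ih => exact .appL _ ih
  | appR a _ ih => exact .appR _ ih
  | lam _ ih => exact .lam ih
  | closL s _ ih => exact .closL _ ih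
  | closR a _ ih => exact .closR _ ih
  | consL s _ ih => exact .consL _ ih
  | consR a _ ih => exact .consR _ ih
  | compL t _ ih => exact .compL _ ih
  | compR s _ ih => exact .compR _ ih

theorem SigmaConv.graft (θ : Grafting ι) {e e' : Expr Γ k} (h : SigmaConv e e') :
    SigmaConv (e.graft θ) (e'.graft θ) :=
  eqvGen_map (Expr.graft θ) (fun _ _ => Step.graft (SigmaRule.graft θ)) h

theorem LambdaSigmaRule.graft (θ : Grafting ι) {e e' : Expr Γ k}
    (h : LambdaSigmaRule Γ k e e') : LambdaSigmaRule Γ k (e.graft θ) (e'.graft θ) := by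
  cases h with
  | sigma h => exact .sigma (h.graft θ)
  | beta a b => exact .beta _ _
  | eta a b h => exact .eta _ _ (h.graft θ)

theorem LambdaSigmaConv.graft (θ : Grafting ι) {e e' : Expr Γ k} (h : LambdaSigmaConv e e') :
    LambdaSigmaConv (e.graft θ) (e'.graft θ) :=
  eqvGen_map (Expr.graft θ) (fun _ _ => Step.graft (LambdaSigmaRule.graft θ)) h

theorem solves_congr (θ : Grafting ι) {a a' b b' : Expr Γ (.tm A)} (ha : LambdaSigmaConv a a')
    (hb : LambdaSigmaConv b b') : Solves θ a b ↔ Solves θ a' b' :=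
  ⟨fun h => .trans _ _ _ (.symm _ _ (ha.graft θ)) (.trans _ _ _ h (hb.graft θ)),
    fun h => .trans _ _ _ (ha.graft θ) (.trans _ _ _ h (.symm _ _ (hb.graft θ)))⟩

theorem Expr.graft_graft (θ θ' : Grafting ι) (e : Expr Γ k) :
    (e.graft θ).graft θ' = e.graft fun Γ A n => (θ Γ A n).graft θ' := by
  induction e <;> simp only [graft, *]

theorem graft_varShift (θ : Grafting ι) (x : Var Γ A) (s : Expr Θ (.sub Γ)) :
    (varShift x s).graft θ = varShift x (s.graft θ) := by
  induction x generalizing Θ with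
  | zero => rfl
  | succ _ ih => exact ih _

theorem graft_precookVar (θ : Grafting ι) (x : Var Γ A) :
    (precookVar x).graft θ = precookVar x := by
  cases x with
  | zero => rfl
  | succ x => exact graft_varShift _ _ _

theorem graft_wkShift (θ : Grafting ι) (w : Wk Γ Δ) (s : Expr Θ (.sub Δ)) :
    (wkShift w s).graft θ = wkShift w (s.graft θ) := by
  induction w generalizing Θ with
  | nil => rfl
  | cons _ ih => exact ih _

theorem graft_lams (θ : Grafting ι) (A : Ty ι) (c : Expr (A.bodyCtx Γ) (.tm (.base A.target))) :
    (lams A c).graft θ = lams A (c.graft θ) := by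
  induction A generalizing Γ with
  | base i => rfl
  | arr A B _ ih => exact congrArg Expr.lam (ih c)

theorem eval_graft_precookAux (θ : Grafting ι) (a : Term Δ A) (w : Wk Γ Δ) :
    ((precookAux a w).graft θ).eval = a.inst (fun A n => (θ Γ A n).eval) w := by
  induction a with
  | var x => simp only [precookAux, graft_precookVar, eval_precookVar, Term.inst]
  | mvar n =>
    cases w with
    | nil => exact (Term.rename_id _).symm
    | cons w =>
      simp only [precookAux, precookMVar, Expr.graft, graft_wkShift, Expr.eval, eval_wkShift,
        Term.inst, Term.rename_eq_subst, Wk.ren]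
  | app a b iha ihb => simp only [precookAux, Expr.graft, Expr.eval, Term.inst, iha, ihb]
  | lam a ih => simp only [precookAux, Expr.graft, Expr.eval, Term.inst, ih]

theorem HasSolution.of_solves_precook {a b : Term Γ A} {θ : Grafting ι}
    (h : Solves θ (precook a) (precook b)) : HasSolution a b := by
  refine ⟨fun A n => (θ Γ A n).eval, ?_⟩
  rw [← eval_graft_precookAux, ← eval_graft_precookAux]
  exact h.eval_equiv

theorem HasSolution.of_solves_graft_precook {a b : Term Γ A} {θ η : Grafting ι}
    (h : Solves θ ((precook a).graft η) ((precook b).graft η)) : HasSolution a b := by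
  rw [Solves, Expr.graft_graft, Expr.graft_graft] at h
  exact .of_solves_precook h

/-! ### Expressions modulo `λσ`-equality -/

/-- Expressions modulo `λσ`-equality. In this quotient the rules of `λσ` are equations, and
rewriting takes the place of congruence arguments. -/
def ExprClass (Γ : Ctx ι) (k : Kind ι) : Type u :=
  Quot (Step LambdaSigmaRule : Expr Γ k → Expr Γ k → Prop)

/-- The class of an expression modulo `λσ`-equality. -/
def Expr.toClass (e : Expr Γ k) : ExprClass Γ k := Quot.mk _ e

theorem toClass_eq_toClass {e e' : Expr Γ k} : e.toClass = e'.toClass ↔ LambdaSigmaConv e e' :=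
  ⟨Quot.eqvGen_exact, Quot.eqvGen_sound⟩

theorem SigmaRule.toClass_eq {e e' : Expr Γ k} (h : SigmaRule Γ k e e') :
    e.toClass = e'.toClass :=
  Quot.sound (.root (.sigma h))

namespace ExprClass

/-- Application of classes of terms. -/
def app : ExprClass Γ (.tm (.arr A B)) → ExprClass Γ (.tm A) → ExprClass Γ (.tm B) :=
  Quot.map₂ Expr.app (fun a _ _ => .appR a) fun _ _ b => .appL b

/-- Abstraction of classes of terms. -/
def lam : ExprClass (A :: Γ) (.tm B) → ExprClass Γ (.tm (.arr A B)) :=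
  Quot.map Expr.lam fun _ _ => .lam

/-- Closure of a class of terms by a class of explicit substitutions. -/
def clos : ExprClass Δ (.tm A) → ExprClass Γ (.sub Δ) → ExprClass Γ (.tm A) :=
  Quot.map₂ Expr.clos (fun a _ _ => .closR a) fun _ _ s => .closL s

/-- Extension of a class of explicit substitutions by a class of terms. -/
def cons : ExprClass Γ (.tm A) → ExprClass Γ (.sub Δ) → ExprClass Γ (.sub (A :: Δ)) :=
  Quot.map₂ Expr.cons (fun a _ _ => .consR a) fun _ _ s => .consL s

/-- Composition of classes of explicit substitutions. -/
def comp : ExprClass Δ (.sub Θ) → ExprClass Γ (.sub Δ) → ExprClass Γ (.sub Θ) :=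
  Quot.map₂ Expr.comp (fun s _ _ => .compR s) fun _ _ t => .compL t

/-- The class of the index `1`. -/
def one : ExprClass (A :: Γ) (.tm A) := Expr.one.toClass

/-- The class of the identity substitution. -/
def id : ExprClass Γ (.sub Γ) := Expr.id.toClass

/-- The class of the shift `↑`. -/
def shift : ExprClass (A :: Γ) (.sub Γ) := Expr.shift.toClass

/-- The substitution `1.(s ∘ ↑)`, which is `s` below one more binder. -/
def lift (s : ExprClass Γ (.sub Δ)) (A : Ty ι) : ExprClass (A :: Γ) (.sub (A :: Δ)) :=
  cons one (comp s shift)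

theorem clos_app (a : ExprClass Δ (.tm (.arr A B))) (b : ExprClass Δ (.tm A))
    (s : ExprClass Γ (.sub Δ)) : clos (app a b) s = app (clos a s) (clos b s) := by
  obtain ⟨a⟩ := a; obtain ⟨b⟩ := b; obtain ⟨s⟩ := s
  exact (SigmaRule.app a b s).toClass_eq

theorem clos_lam (a : ExprClass (A :: Δ) (.tm B)) (s : ExprClass Γ (.sub Δ)) :
    clos (lam a) s = lam (clos a (lift s A)) := by
  obtain ⟨a⟩ := a; obtain ⟨s⟩ := s
  exact (SigmaRule.abs a s).toClass_eq

theorem clos_clos (a : ExprClass Θ (.tm A)) (s : ExprClass Δ (.sub Θ)) (t : ExprClass Γ (.sub Δ)) :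
    clos (clos a s) t = clos a (comp s t) := by
  obtain ⟨a⟩ := a; obtain ⟨s⟩ := s; obtain ⟨t⟩ := t
  exact (SigmaRule.clos a s t).toClass_eq

theorem clos_id (a : ExprClass Γ (.tm A)) : clos a id = a := by
  obtain ⟨a⟩ := a
  exact (SigmaRule.id a).toClass_eq

theorem clos_one_cons (a : ExprClass Γ (.tm A)) (s : ExprClass Γ (.sub Δ)) :
    clos one (cons a s) = a := by
  obtain ⟨a⟩ := a; obtain ⟨s⟩ := s
  exact (SigmaRule.varCons a s).toClass_eq

theorem id_comp (s : ExprClass Γ (.sub Δ)) : comp id s = s := by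
  obtain ⟨s⟩ := s
  exact (SigmaRule.idL s).toClass_eq

theorem comp_id (s : ExprClass Γ (.sub Δ)) : comp s id = s := by
  obtain ⟨s⟩ := s
  exact (SigmaRule.idR s).toClass_eq

theorem comp_assoc {Ξ : Ctx ι} (s : ExprClass Θ (.sub Ξ)) (t : ExprClass Δ (.sub Θ))
    (r : ExprClass Γ (.sub Δ)) : comp (comp s t) r = comp s (comp t r) := by
  obtain ⟨s⟩ := s; obtain ⟨t⟩ := t; obtain ⟨r⟩ := r
  exact (SigmaRule.assEnv s t r).toClass_eq

theorem shift_comp_cons (a : ExprClass Γ (.tm A)) (s : ExprClass Γ (.sub Δ)) :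
    comp shift (cons a s) = s := by
  obtain ⟨a⟩ := a; obtain ⟨s⟩ := s
  exact (SigmaRule.shiftCons a s).toClass_eq

theorem app_lam (a : ExprClass (A :: Γ) (.tm B)) (b : ExprClass Γ (.tm A)) :
    app (lam a) b = clos a (cons b id) := by
  obtain ⟨a⟩ := a; obtain ⟨b⟩ := b
  exact Quot.sound (.root (.beta a b))

theorem lam_app_clos_shift_one (a : ExprClass Γ (.tm (.arr A B))) :
    lam (app (clos a shift) one) = a := by
  obtain ⟨a⟩ := a
  exact Quot.sound (.root (.eta _ a (.refl _)))

end ExprClass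

open ExprClass

/-! ### Precooking commutes with substitution -/

/-- The class of `1[↑ᵏ]`, for the de Bruijn index `1 + k`. -/
def Var.toClass {Γ : Ctx ι} : Var Γ A → ExprClass Γ (.tm A)
  | .zero => one
  | .succ x => clos x.toClass shift

/-- The class of `↑ⁿ`, for `Δ` that extends `Γ` by `n` types. -/
def Wk.toClass {Δ : Ctx ι} : Wk Γ Δ → ExprClass Δ (.sub Γ)
  | .nil => id
  | .cons w => comp w.toClass shift

theorem toClass_varShift (x : Var Γ A) (s : Expr Θ (.sub Γ)) :
    (varShift x s).toClass = clos x.toClass s.toClass := by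
  induction x generalizing Θ with
  | zero => rfl
  | succ x ih => exact (ih _).trans (clos_clos x.toClass shift s.toClass).symm

theorem toClass_precookVar (x : Var Γ A) : (precookVar x).toClass = x.toClass := by
  cases x with
  | zero => rfl
  | succ x => exact toClass_varShift x .shift

theorem toClass_wkShift (w : Wk Γ Δ) (s : Expr Θ (.sub Δ)) :
    (wkShift w s).toClass = comp w.toClass s.toClass := by
  induction w generalizing Θ with
  | nil => exact (id_comp s.toClass).symm
  | cons w ih => exact (ih _).trans (comp_assoc w.toClass shift s.toClass).symm

theorem toClass_graft_precookMVar (θ : Grafting ι) (m : ℕ) (w : Wk Γ Δ) :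
    ((precookMVar m w : Expr Δ (.tm A)).graft θ).toClass = clos (θ Γ A m).toClass w.toClass := by
  cases w with
  | nil => exact (clos_id _).symm
  | cons w =>
    rw [precookMVar, Expr.graft, graft_wkShift]
    exact congrArg (clos (θ Γ A m).toClass) (toClass_wkShift w .shift)

theorem toClass_precookMVar (m : ℕ) (w : Wk Γ Δ) :
    (precookMVar m w : Expr Δ (.tm A)).toClass =
      clos (.mvar m : Expr Γ (.tm A)).toClass w.toClass := by
  cases w with
  | nil => exact (clos_id _).symm
  | cons w => exact congrArg (clos (Expr.mvar m).toClass) (toClass_wkShift w .shift)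

theorem toClass_precookMVar_of_comp_eq {w : Wk Γ Δ} {w' : Wk Γ Θ} {s : ExprClass Θ (.sub Δ)}
    (hw : comp w.toClass s = w'.toClass) (m : ℕ) :
    (precookMVar m w' : Expr Θ (.tm A)).toClass = clos (precookMVar m w).toClass s := by
  rw [toClass_precookMVar, toClass_precookMVar, clos_clos, hw]

theorem comp_toClass_cons_lift {w : Wk Γ Δ} {w' : Wk Γ Θ} {s : ExprClass Θ (.sub Δ)}
    (hw : comp w.toClass s = w'.toClass) (B : Ty ι) :
    comp w.cons.toClass (s.lift B) = (w'.cons (A := B)).toClass := by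
  rw [Wk.toClass, lift, comp_assoc, shift_comp_cons, ← comp_assoc, hw, Wk.toClass]

theorem clos_toClass_succ_lift (x : Var Δ A) (s : ExprClass Γ (.sub Δ)) (B : Ty ι) :
    clos (x.succ.toClass) (s.lift B) = clos (clos x.toClass s) shift := by
  rw [Var.toClass, lift, clos_clos, shift_comp_cons, clos_clos]

theorem toClass_precookAux_rename (a : Term Δ A) {w : Wk Γ Δ} {w' : Wk Γ Θ} {ρ : Ren Δ Θ}
    {s : ExprClass Θ (.sub Δ)} (hw : comp w.toClass s = w'.toClass)
    (hρ : ∀ A x, (ρ A x).toClass = clos x.toClass s) :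
    (precookAux (a.rename ρ) w').toClass = clos (precookAux a w).toClass s := by
  induction a generalizing Θ with
  | var x => simpa only [Term.rename, precookAux, toClass_precookVar] using hρ _ x
  | mvar m => exact toClass_precookMVar_of_comp_eq hw m
  | app a b iha ihb =>
    exact (congrArg₂ app (iha hw hρ) (ihb hw hρ)).trans (clos_app _ _ _).symm
  | lam a ih =>
    refine (congrArg lam (ih (comp_toClass_cons_lift hw _) fun A x => ?_)).trans
      (clos_lam _ _).symm
    cases x with
    | zero => exact (clos_one_cons _ _).symm
    | succ x => rw [liftRen, clos_toClass_succ_lift, ← hρ, Var.toClass]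

theorem toClass_precookAux_weaken (a : Term Δ A) (w : Wk Γ Δ) (B : Ty ι) :
    (precookAux (a.weaken B) w.cons).toClass = clos (precookAux a w).toClass shift :=
  toClass_precookAux_rename a rfl fun _ _ => rfl

theorem toClass_wk_ren (w : Wk Γ Δ) (x : Var Γ A) :
    (w.ren A x).toClass = clos x.toClass w.toClass := by
  induction w with
  | nil => exact (clos_id _).symm
  | cons w ih => rw [Wk.ren, Var.toClass, ih, clos_clos, Wk.toClass]

theorem toClass_precookAux_rename_wk_ren (a : Term Γ A) (w : Wk Γ Δ) :
    (precookAux (a.rename w.ren) w).toClass = clos (precook a).toClass w.toClass :=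
  toClass_precookAux_rename a (id_comp _) fun _ => toClass_wk_ren w

theorem toClass_precookAux_subst (a : Term Δ A) {w : Wk Γ Δ} {w' : Wk Γ Θ} {τ : Subst Δ Θ}
    {s : ExprClass Θ (.sub Δ)} (hw : comp w.toClass s = w'.toClass)
    (hτ : ∀ A x, (precookAux (τ A x) w').toClass = clos x.toClass s) :
    (precookAux (a.subst τ) w').toClass = clos (precookAux a w).toClass s := by
  induction a generalizing Θ with
  | var x => simpa only [Term.subst, precookAux, toClass_precookVar] using hτ _ x
  | mvar m => exact toClass_precookMVar_of_comp_eq hw m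
  | app a b iha ihb =>
    exact (congrArg₂ app (iha hw hτ) (ihb hw hτ)).trans (clos_app _ _ _).symm
  | lam a ih =>
    refine (congrArg lam (ih (comp_toClass_cons_lift hw _) fun A x => ?_)).trans
      (clos_lam _ _).symm
    cases x with
    | zero => exact (clos_one_cons _ _).symm
    | succ x => rw [liftSub, clos_toClass_succ_lift, ← hτ, toClass_precookAux_weaken]

theorem toClass_precookAux_subst_single (a : Term (A :: Δ) B) (b : Term Δ A) (w : Wk Γ Δ) :
    (precookAux (a.subst (single b)) w).toClass =
      clos (precookAux a w.cons).toClass (cons (precookAux b w).toClass id) := by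
  refine toClass_precookAux_subst a ?_ fun C x => ?_
  · rw [Wk.toClass, comp_assoc, shift_comp_cons, comp_id]
  · cases x with
    | zero => exact (clos_one_cons _ _).symm
    | succ x =>
      rw [single, precookAux, toClass_precookVar, Var.toClass, clos_clos, shift_comp_cons, clos_id]

theorem toClass_precookAux_eta (a : Term Δ (.arr A B)) (w : Wk Γ Δ) :
    (precookAux (.lam (.app (a.weaken A) (.var .zero))) w).toClass = (precookAux a w).toClass :=
  calc (precookAux (.lam (.app (a.weaken A) (.var .zero))) w).toClass
      = lam (app (precookAux (a.weaken A) w.cons).toClass one) := rfl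
    _ = lam (app (clos (precookAux a w).toClass shift) one) := by rw [toClass_precookAux_weaken]
    _ = (precookAux a w).toClass := lam_app_clos_shift_one _

theorem BetaEta.toClass_precookAux_eq {a b : Term Δ A} (h : BetaEta a b) (w : Wk Γ Δ) :
    (precookAux a w).toClass = (precookAux b w).toClass := by
  induction h with
  | beta a b => exact (app_lam _ _).trans (toClass_precookAux_subst_single a b w).symm
  | eta a => exact toClass_precookAux_eta a w
  | appL b _ ih => exact congrArg (app · (precookAux b w).toClass) (ih w)
  | appR a _ ih => exact congrArg (app (precookAux a w).toClass) (ih w)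
  | lam _ ih => exact congrArg ExprClass.lam (ih w.cons)

theorem BetaEtaConv.toClass_precook_eq {a b : Term Γ A} (h : BetaEtaConv a b) :
    (precook a).toClass = (precook b).toClass :=
  Setoid.eqvGen_le (s := Setoid.ker fun a : Term Γ A => (precook a).toClass)
    (fun _ _ h => h.toClass_precookAux_eq .nil) h

/-! ### Precooking and instantiation -/

theorem mvars_wkShift (w : Wk Γ Δ) (s : Expr Θ (.sub Δ)) : (wkShift w s).mvars = s.mvars := by
  induction w generalizing Θ with
  | nil => rfl
  | cons _ ih => simp [wkShift, ih, Expr.mvars]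

theorem mvars_precookMVar (m : ℕ) (w : Wk Γ Δ) :
    (precookMVar m w : Expr Δ (.tm A)).mvars = {⟨m, Γ, A⟩} := by
  cases w <;> simp [precookMVar, Expr.mvars, mvars_wkShift]

theorem toClass_graft_precookAux (a : Term Δ A) (w : Wk Γ Δ) {θ : Grafting ι}
    {τ : ∀ A : Ty ι, ℕ → Term Γ A}
    (h : ∀ A n, ⟨n, Γ, A⟩ ∈ (precookAux a w).mvars →
      (θ Γ A n).toClass = (precook (τ A n)).toClass) :
    ((precookAux a w).graft θ).toClass = (precookAux (a.inst τ w) w).toClass := by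
  induction a with
  | var x => rw [precookAux, graft_precookVar, Term.inst, precookAux]
  | @mvar _ A m =>
    have hm : ⟨m, Γ, A⟩ ∈ (precookMVar m w : Expr _ (.tm A)).mvars := by
      rw [mvars_precookMVar, Set.mem_singleton_iff]
    rw [precookAux, toClass_graft_precookMVar, h A m hm, Term.inst,
      toClass_precookAux_rename_wk_ren]
  | app a b iha ihb =>
    exact congrArg₂ app (iha w fun A n hn => h A n (.inl hn)) (ihb w fun A n hn => h A n (.inr hn))
  | lam a ih => exact congrArg lam (ih w.cons h)

/-! ### Precooked terms are simple and `σ`-normal -/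

theorem IsShiftPow.isSimple {n : ℕ} {s : Expr Γ (.sub Δ)} (h : IsShiftPow n s) : s.IsSimple := by
  induction h with
  | zero | one => trivial
  | succ _ ih => exact ⟨trivial, ih⟩

theorem IsShiftPow.exists_wkShift {n : ℕ} (w : Wk Γ Δ) {s : Expr Θ (.sub Δ)}
    (h : IsShiftPow (n + 1) s) : ∃ m, IsShiftPow (m + 1) (wkShift w s) := by
  induction w generalizing Θ n with
  | nil => exact ⟨n, h⟩
  | cons _ ih => exact ih h.succ

theorem IsShiftPow.exists_varShift_eq {n : ℕ} (x : Var Γ A) {s : Expr Θ (.sub Γ)}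
    (h : IsShiftPow (n + 1) s) :
    ∃ (m : ℕ) (Δ : Ctx ι) (t : Expr Θ (.sub (A :: Δ))),
      IsShiftPow (m + 1) t ∧ varShift x s = .clos .one t := by
  induction x generalizing Θ n with
  | zero => exact ⟨n, _, s, h, rfl⟩
  | succ _ ih => exact ih h.succ

theorem isSigmaNormal_one : IsSigmaNormal (.one : Expr (A :: Γ) (.tm A)) := by
  rintro _ (⟨⟨⟩⟩ | _)

theorem isSigmaNormal_mvar (n : ℕ) : IsSigmaNormal (.mvar n : Expr Γ (.tm A)) := by
  rintro _ (⟨⟨⟩⟩ | _)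

theorem isSigmaNormal_shift : IsSigmaNormal (.shift : Expr (A :: Γ) (.sub Γ)) := by
  rintro _ (⟨⟨⟩⟩ | _)

theorem IsSigmaNormal.app {a : Expr Γ (.tm (.arr A B))} {b : Expr Γ (.tm A)}
    (ha : IsSigmaNormal a) (hb : IsSigmaNormal b) : IsSigmaNormal (.app a b) := by
  intro _ h
  cases h with
  | root h => cases h
  | appL _ h => exact ha _ h
  | appR _ h => exact hb _ h

theorem IsSigmaNormal.lam {a : Expr (A :: Γ) (.tm B)} (ha : IsSigmaNormal a) :
    IsSigmaNormal (.lam a) := by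
  intro _ h
  cases h with
  | root h => cases h
  | lam h => exact ha _ h

theorem IsShiftPow.isSigmaNormal {n : ℕ} {s : Expr Γ (.sub Δ)} (h : IsShiftPow n s) :
    IsSigmaNormal s := by
  induction h with
  | zero => rintro _ (⟨⟨⟩⟩ | _)
  | one => exact isSigmaNormal_shift
  | succ hs ih =>
    intro _ h
    cases h with
    | root h => cases h <;> cases hs
    | compL _ h => exact isSigmaNormal_shift _ h
    | compR _ h => exact ih _ h

theorem IsShiftPow.isSigmaNormal_clos_one {n : ℕ} {s : Expr Γ (.sub (A :: Δ))}
    (hs : IsShiftPow (n + 1) s) : IsSigmaNormal (.clos .one s) := by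
  intro _ h
  cases h with
  | root h => cases h <;> cases hs
  | closL _ h => exact isSigmaNormal_one _ h
  | closR _ h => exact hs.isSigmaNormal _ h

theorem IsShiftPow.isSigmaNormal_clos_mvar {n : ℕ} {s : Expr Γ (.sub Δ)}
    (hs : IsShiftPow (n + 1) s) (m : ℕ) :
    IsSigmaNormal (.clos (.mvar m : Expr Δ (.tm A)) s) := by
  intro _ h
  cases h with
  | root h => cases h; cases hs
  | closL _ h => exact isSigmaNormal_mvar _ _ h
  | closR _ h => exact hs.isSigmaNormal _ h

theorem isSimple_precookVar (x : Var Γ A) : (precookVar x).IsSimple := by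
  cases x with
  | zero => trivial
  | succ x =>
    obtain ⟨_, _, t, ht, hx⟩ := IsShiftPow.one.exists_varShift_eq x
    rw [precookVar, hx]
    exact ⟨False.elim, trivial, ht.isSimple⟩

theorem isSigmaNormal_precookVar (x : Var Γ A) : IsSigmaNormal (precookVar x) := by
  cases x with
  | zero => exact isSigmaNormal_one
  | succ x =>
    obtain ⟨_, _, t, ht, hx⟩ := IsShiftPow.one.exists_varShift_eq x
    rw [precookVar, hx]
    exact ht.isSigmaNormal_clos_one

theorem isSimple_precookMVar (m : ℕ) (w : Wk Γ Δ) :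
    (precookMVar m w : Expr Δ (.tm A)).IsSimple := by
  cases w with
  | nil => trivial
  | cons w =>
    obtain ⟨n, hn⟩ := IsShiftPow.one.exists_wkShift w
    exact ⟨fun _ => ⟨_, hn⟩, trivial, hn.isSimple⟩

theorem isSigmaNormal_precookMVar (m : ℕ) (w : Wk Γ Δ) :
    IsSigmaNormal (precookMVar m w : Expr Δ (.tm A)) := by
  cases w with
  | nil => exact isSigmaNormal_mvar m
  | cons w =>
    obtain ⟨n, hn⟩ := IsShiftPow.one.exists_wkShift w
    exact hn.isSigmaNormal_clos_mvar m

theorem isSimple_precookAux (a : Term Δ A) (w : Wk Γ Δ) : (precookAux a w).IsSimple := by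
  induction a with
  | var x => exact isSimple_precookVar x
  | mvar m => exact isSimple_precookMVar m w
  | app a b iha ihb => exact ⟨iha w, ihb w⟩
  | lam _ ih => exact ih w.cons

theorem isSigmaNormal_precookAux (a : Term Δ A) (w : Wk Γ Δ) :
    IsSigmaNormal (precookAux a w) := by
  induction a with
  | var x => exact isSigmaNormal_precookVar x
  | mvar m => exact isSigmaNormal_precookMVar m w
  | app a b iha ihb => exact (iha w).app (ihb w)
  | lam a ih => exact (ih w.cons).lam

/-! ### Solving for the new variables -/

/-- For `t` of type `A₁ → ⋯ → Aₙ → B` with `B` atomic, the body `t⁺ n ⋯ 1` of its `η`-expansion. -/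
def etaBody : (A : Ty ι) → {Γ : Ctx ι} → Term Γ A → Term (A.bodyCtx Γ) (.base A.target)
  | .base _, _, t => t
  | .arr A B, _, t => etaBody B (.app (t.weaken A) (.var .zero))

/-- The position of the body of `λ_{A₁} ⋯ λ_{Aₙ}`, which is `n` binders below that of the
abstraction. -/
def bodyWk : (A : Ty ι) → {Δ : Ctx ι} → Wk Γ Δ → Wk Γ (A.bodyCtx Δ)
  | .base _, _, w => w
  | .arr _ B, _, w => bodyWk B w.cons

theorem toClass_lams_precookAux_etaBody (t : Term Δ A) (w : Wk Γ Δ) :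
    (lams A (precookAux (etaBody A t) (bodyWk A w))).toClass = (precookAux t w).toClass := by
  induction A generalizing Δ with
  | base i => rfl
  | arr A B _ ih => exact (congrArg lam (ih _ w.cons)).trans (toClass_precookAux_eta t w)

theorem exists_grafting_eq_of_injOn {I : Type*} {S : Set I} {f : I → MVar ι} (hf : Set.InjOn f S)
    (F : ∀ i, Expr (f i).ctx (.tm (f i).ty)) :
    ∃ θ : Grafting ι, (∀ i ∈ S, θ (f i).ctx (f i).ty (f i).name = F i) ∧
      ∀ Z ∉ f '' S, θ Z.ctx Z.ty Z.name = .mvar Z.name := by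
  have exists_value (Z : MVar ι) : ∃ e : Expr Z.ctx (.tm Z.ty),
      (∀ i ∈ S, ∀ h : f i = Z, h ▸ F i = e) ∧ (Z ∉ f '' S → e = .mvar Z.name) := by
    by_cases hZ : Z ∈ f '' S
    · obtain ⟨i, hi, rfl⟩ := hZ
      refine ⟨F i, fun j hj h => ?_, fun h => absurd ⟨i, hi, rfl⟩ h⟩
      obtain rfl := hf hj hi h
      rfl
    · exact ⟨.mvar Z.name, fun i hi h => absurd ⟨i, hi, h⟩ hZ, fun _ => rfl⟩
  choose e he he' using exists_value
  exact ⟨fun Γ A n => e ⟨n, Γ, A⟩, fun i hi => (he _ i hi rfl).symm, fun Z => he' Z⟩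

section

variable {y : MVar ι → ℕ} {V : Set (MVar ι)} {τ : ∀ A : Ty ι, ℕ → Term Γ A}

variable (τ) in
theorem exists_isSimple_isSigmaNormal_grafting (hy : Set.InjOn (bodyVar y) V) :
    ∃ θ : Grafting ι, (θ.IsSimple ∧ ∀ Δ A n, IsSigmaNormal (θ Δ A n)) ∧
      ∀ A n, ⟨n, Γ, A⟩ ∈ V →
        θ (A.bodyCtx Γ) (.base A.target) (y ⟨n, Γ, A⟩) =
          precookAux (etaBody A (τ A n)) (bodyWk A .nil) := by
  let X (p : Ty ι × ℕ) : MVar ι := ⟨p.2, Γ, p.1⟩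
  have hX : X.Injective := by
    rintro ⟨A, n⟩ ⟨B, m⟩ h
    cases h
    rfl
  have hinj : Set.InjOn (bodyVar y ∘ X) (X ⁻¹' V) :=
    hy.comp hX.injOn fun _ hp => hp
  obtain ⟨θ, hθ, hθ'⟩ := exists_grafting_eq_of_injOn hinj
    fun p => precookAux (etaBody p.1 (τ p.1 p.2)) (bodyWk p.1 .nil)
  have value (Z : MVar ι) : (θ Z.ctx Z.ty Z.name).IsSimple ∧
      IsSigmaNormal (θ Z.ctx Z.ty Z.name) := by
    by_cases hZ : Z ∈ (bodyVar y ∘ X) '' (X ⁻¹' V)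
    · obtain ⟨p, hp, rfl⟩ := hZ
      rw [hθ p hp]
      exact ⟨isSimple_precookAux _ _, isSigmaNormal_precookAux _ _⟩
    · rw [hθ' Z hZ]
      exact ⟨trivial, isSigmaNormal_mvar _⟩
  exact ⟨θ, ⟨fun Δ A n => (value ⟨n, Δ, A⟩).1, fun Δ A n => (value ⟨n, Δ, A⟩).2⟩,
    fun A n hn => hθ (A, n) hn⟩

theorem toClass_graft_graft_expand {θ : Grafting ι}
    (hθ : ∀ A n, ⟨n, Γ, A⟩ ∈ V →
      θ (A.bodyCtx Γ) (.base A.target) (y ⟨n, Γ, A⟩) =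
        precookAux (etaBody A (τ A n)) (bodyWk A .nil))
    {a : Term Γ A} (ha : (precook a).mvars ⊆ V) :
    (((precook a).graft (expand y V)).graft θ).toClass = (precook (a.inst τ .nil)).toClass := by
  rw [Expr.graft_graft]
  refine toClass_graft_precookAux a .nil fun A n hn => ?_
  rw [expand, if_pos (ha hn), graft_lams, Expr.graft, hθ A n (ha hn)]
  exact toClass_lams_precookAux_etaBody (τ A n) .nil

theorem HasSolution.exists_solves_graft_expand {a b : Term Γ A} (h : HasSolution a b)
    (hy : Set.InjOn (bodyVar y) V) (ha : (precook a).mvars ⊆ V) (hb : (precook b).mvars ⊆ V) :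
    ∃ θ : Grafting ι, (θ.IsSimple ∧ ∀ Δ A n, IsSigmaNormal (θ Δ A n)) ∧
      Solves θ ((precook a).graft (expand y V)) ((precook b).graft (expand y V)) := by
  obtain ⟨τ, hτ⟩ := h
  obtain ⟨θ, hθ, hθτ⟩ := exists_isSimple_isSigmaNormal_grafting τ hy
  refine ⟨θ, hθ, toClass_eq_toClass.1 ?_⟩
  rw [toClass_graft_graft_expand hθτ ha, toClass_graft_graft_expand hθτ hb,
    hτ.toClass_precook_eq]

end

theorem IsNormalForm.lambdaSigmaConv {e e' : Expr Γ k} (h : IsNormalForm e e') :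
    LambdaSigmaConv e e' :=
  Relation.EqvGen.reflTransGen_le_eqvGen _ _ _ h.1

end LambdaSigma

theorem mainTheorem3_general {ι : Type*} {Γ : Ctx ι} {T : Ty ι} {a b : Term Γ T}
    {y : MVar ι → ℕ} {V : Set (MVar ι)} (hy : Set.InjOn (bodyVar y) V)
    (ha : (precook a).mvars ⊆ V) (hb : (precook b).mvars ⊆ V) {a' b' : Expr Γ (.tm T)}
    (ha' : LambdaSigmaConv ((precook a).graft (expand y V)) a')
    (hb' : LambdaSigmaConv ((precook b).graft (expand y V)) b') :
    List.TFAE [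
      ∃ θ : Grafting ι, Solves θ a' b',
      HasSolution a b,
      ∃ θ : Grafting ι, θ.IsSimple ∧ Solves θ a' b',
      ∃ θ : Grafting ι, (θ.IsSimple ∧ ∀ Δ A n, IsSigmaNormal (θ Δ A n)) ∧ Solves θ a' b'] := by
  have solves_iff (θ : Grafting ι) := solves_congr θ ha' hb'
  tfae_have 1 → 2 := fun ⟨θ, h⟩ => .of_solves_graft_precook ((solves_iff θ).2 h)
  tfae_have 2 → 4 := fun h =>
    let ⟨θ, hθ, hs⟩ := h.exists_solves_graft_expand hy ha hb
    ⟨θ, hθ, (solves_iff θ).1 hs⟩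
  tfae_have 4 → 3 := fun ⟨θ, hθ, h⟩ => ⟨θ, hθ.1, h⟩
  tfae_have 3 → 1 := fun ⟨θ, _, h⟩ => ⟨θ, h⟩
  tfae_finish

theorem mainTheorem3 {ι : Type*} {Γ : Ctx ι} {T : Ty ι} (a b : Term Γ T)
    (y : MVar ι → ℕ) (hy : IsFresh y ((precook a).mvars ∪ (precook b).mvars))
    (a' b' : Expr Γ (.tm T))
    (ha' : IsNormalForm
      ((precook a).graft (expand y ((precook a).mvars ∪ (precook b).mvars))) a')
    (hb' : IsNormalForm
      ((precook b).graft (expand y ((precook a).mvars ∪ (precook b).mvars))) b') :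
    List.TFAE [
      HasSolution a b,
      ∃ θ : Grafting ι, θ.IsSimple ∧ Solves θ a' b',
      ∃ θ : Grafting ι, (θ.IsSimple ∧ ∀ Δ A n, IsSigmaNormal (θ Δ A n)) ∧ Solves θ a' b'] := by
  exact (List.tfae_cons_cons.1 (mainTheorem3_general hy.1 Set.subset_union_left
    Set.subset_union_right ha'.lambdaSigmaConv hb'.lambdaSigmaConv)).2
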